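/- Let $\mathfrak H$ be a real or complex Hilbert space with inner product $(\cdot,\cdot)$. A positive, symmetric operator $a$ in $\mathfrak H$ is a linear map $a:\operatorname{dom}a\to\mathfrak H$ on a linear subspace $\operatorname{dom}a\subseteq\mathfrak H$, not necessarily dense, with $(au,v)=(u,av)$ and $(au,u)\ge 0$ for all $u,v\in\operatorname{dom}a$. Its form domain is $$\operatorname{fdom}a=\{y\in\mathfrak H:\ \exists\, m_y\in\mathbb R\ \ \forall u\in\operatorname{dom}a\ \ |(au,y)|^2\le m_y\,(au,u)\}.$$ If $\operatorname{fdom}a$ is dense, then $\langle au,av\rangle=(au,v)$ is an inner product on $\operatorname{ran}a$; let $\mathfrak H_a$ be the completion of $\operatorname{ran}a$ with respect to it. If $a,b$ are positive, symmetric operators such that $\operatorname{fdom}a\cap\operatorname{fdom}b$ is dense in $\mathfrak H$, let $J:\mathfrak H_a\oplus\mathfrak H_b\to\mathfrak H$ be the operator with $\operatorname{dom}J=\operatorname{ran}a\oplus\operatorname{ran}b$ and $J(au\oplus bv)=au+bv$. The form sum of $a$ and $b$ is the operator $a\stackrel{.}{+}b=J^{**}J^{*}$ in $\mathfrak H$,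 with its natural domain. Theorem. Let $a$ and $b$ be positive, symmetric operators in $\mathfrak H$ with $\operatorname{fdom}a\cap\operatorname{fdom}b$ dense in $\mathfrak H$, and let $D\subseteq\operatorname{dom}a\cap\operatorname{dom}b$ be a linear manifold (a linear subspace, not necessarily closed). Then $\operatorname{fdom}(a|_D)\cap\operatorname{fdom}(b|_D)$ is dense in $\mathfrak H$ as well, and $$a|_D\stackrel{.}{+}b|_D=a\stackrel{.}{+}b$$ (equality of operators, including their domains) if and only if for all $x\in\mathfrak H$ $$\sup_{\substack{u\in\operatorname{dom}a\\(au,u)\le1}}|(au,x)|^2+\sup_{\substack{v\in\operatorname{dom}b\\(bv,v)\le1}}|(bv,x)|^2=\sup_{\substack{u\in D\\(au,u)\le1}}|(au,x)|^2+\sup_{\substack{v\in D\\(bv,v)\le1}}|(bv,x)|^2,$$ where the suprema are taken in $[0,\infty]$. -/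

import Mathlib

open scoped InnerProductSpace

noncomputable section

namespace FormSum

variable {𝕜 : Type*} [RCLike 𝕜] {H : Type*} [NormedAddCommGroup H] [InnerProductSpace 𝕜 H]

/-- A partially defined operator (domain not necessarily dense) is positive and symmetric. -/
structure IsPosSymm (a : H →ₗ.[𝕜] H) : Prop where
  symm : a.IsFormalAdjoint a
  nonneg : ∀ u : a.domain, 0 ≤ RCLike.re ⟪a u, (u : H)⟫_𝕜

/-- The form domain of `a`. -/
def fdom (a : H →ₗ.[𝕜] H) : Set H :=
  {y | ∃ m : ℝ, ∀ u : a.domain, ‖⟪a u, y⟫_𝕜‖ ^ 2 ≤ m * RCLike.re ⟪a u, (u : H)⟫_𝕜}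

theorem IsPosSymm.domRestrict {a : H →ₗ.[𝕜] H} (ha : IsPosSymm a) (D : Submodule 𝕜 H) :
    IsPosSymm (a.domRestrict D) where
  symm u v := ha.symm (Submodule.inclusion inf_le_right u) (Submodule.inclusion inf_le_right v)
  nonneg u := ha.nonneg (Submodule.inclusion inf_le_right u)

theorem fdom_subset_fdom_domRestrict (a : H →ₗ.[𝕜] H) (D : Submodule 𝕜 H) :
    fdom a ⊆ fdom (a.domRestrict D) :=
  fun _ ⟨m, hm⟩ => ⟨m, fun u => hm (Submodule.inclusion inf_le_right u)⟩

theorem dense_fdom_inter_domRestrict {a b : H →ₗ.[𝕜] H} (hd : Dense (fdom a ∩ fdom b))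
    (D : Submodule 𝕜 H) : Dense (fdom (a.domRestrict D) ∩ fdom (b.domRestrict D)) :=
  hd.mono (Set.inter_subset_inter (fdom_subset_fdom_domRestrict a D)
    (fdom_subset_fdom_domRestrict b D))

/-- The vector space `ran a`; it carries the inner product `⟨a u, a v⟩ = (a u, v)` below, and not
the one of `H`. -/
def Ran (a : H →ₗ.[𝕜] H) (_ha : IsPosSymm a) : Type _ := LinearMap.range a.toFun

variable {a b : H →ₗ.[𝕜] H}

instance (ha : IsPosSymm a) : AddCommGroup (Ran a ha) :=
  inferInstanceAs (AddCommGroup (LinearMap.range a.toFun))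

instance (ha : IsPosSymm a) : Module 𝕜 (Ran a ha) :=
  inferInstanceAs (Module 𝕜 (LinearMap.range a.toFun))

/-- The inclusion of `ran a` in `H`. -/
def Ran.val (ha : IsPosSymm a) : Ran a ha →ₗ[𝕜] H := (LinearMap.range a.toFun).subtype

/-- The element `a u` of `ran a`. -/
def Ran.mk (ha : IsPosSymm a) (u : a.domain) : Ran a ha := ⟨a u, u, rfl⟩

/-- Some preimage under `a` of an element of `ran a`. -/
def Ran.pre (ha : IsPosSymm a) (ξ : Ran a ha) : a.domain := ξ.2.choose

theorem Ran.apply_pre (ha : IsPosSymm a) (ξ : Ran a ha) : a (ξ.pre ha) = ξ.val ha :=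
  ξ.2.choose_spec

/-- The (semi-)inner product on `ran a`: `⟨a u, a v⟩ = (a u, v)`, independent of the choice
of the preimage `v` by symmetry, see `Ran.inner_mk`. -/
abbrev Ran.core (ha : IsPosSymm a) : PreInnerProductSpace.Core 𝕜 (Ran a ha) where
  inner ξ η := ⟪ξ.val ha, (η.pre ha : H)⟫_𝕜
  conj_inner_symm ξ η := by
    rw [inner_conj_symm, ← Ran.apply_pre, ← Ran.apply_pre]
    exact (ha.symm _ _).symm
  re_inner_nonneg ξ := by
    rw [← Ran.apply_pre]
    exact ha.nonneg _
  add_left ξ η ζ := by rw [map_add, inner_add_left]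
  smul_left ξ η c := by rw [map_smul, inner_smul_left]

instance (ha : IsPosSymm a) : SeminormedAddCommGroup (Ran a ha) :=
  InnerProductSpace.Core.toSeminormedAddCommGroup (c := Ran.core ha)

instance (ha : IsPosSymm a) : InnerProductSpace 𝕜 (Ran a ha) :=
  InnerProductSpace.ofCore (Ran.core ha)

theorem Ran.inner_mk (ha : IsPosSymm a) (u v : a.domain) :
    ⟪Ran.mk ha u, Ran.mk ha v⟫_𝕜 = ⟪a u, (v : H)⟫_𝕜 := by
  have h : a ((Ran.mk ha v).pre ha) = a v := Ran.apply_pre ha _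
  change ⟪a u, ((Ran.mk ha v).pre ha : H)⟫_𝕜 = _
  rw [ha.symm, h, ha.symm]

theorem Ran.mk_pre (ha : IsPosSymm a) (ξ : Ran a ha) : Ran.mk ha (ξ.pre ha) = ξ :=
  Subtype.ext (Ran.apply_pre ha ξ)

/-- If the form domain is dense, the inner product on `ran a` is definite. -/
theorem Ran.eq_zero_of_norm_eq_zero (ha : IsPosSymm a) (hd : Dense (fdom a)) {ξ : Ran a ha}
    (h : ‖ξ‖ = 0) : ξ = 0 := by
  have h0 : RCLike.re ⟪a (ξ.pre ha), (ξ.pre ha : H)⟫_𝕜 = 0 := by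
    rw [← Ran.inner_mk ha, Ran.mk_pre, inner_self_eq_norm_sq, h]
    simp
  have h1 : a (ξ.pre ha) = 0 := hd.eq_zero_of_inner_left 𝕜 (by
    rintro y ⟨m, hm⟩
    have h2 := hm (ξ.pre ha)
    rw [h0, mul_zero] at h2
    exact norm_eq_zero.1 (pow_eq_zero_iff two_ne_zero |>.1 (le_antisymm h2 (sq_nonneg _))))
  rw [Ran.apply_pre] at h1
  exact Subtype.ext h1

/-- The Hilbert space obtained by completing `ran a` with the inner product
`⟨a u, a v⟩ = (a u, v)`. -/
abbrev Hil (a : H →ₗ.[𝕜] H) (ha : IsPosSymm a) : Type _ := UniformSpace.Completion (Ran a ha)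

/-- The canonical map of `ran a ⊕ ran b` into the Hilbert space sum of the completions. -/
def ι (ha : IsPosSymm a) (hb : IsPosSymm b) :
    Ran a ha × Ran b hb →ₗ[𝕜] WithLp 2 (Hil a ha × Hil b hb) :=
  (WithLp.linearEquiv 2 𝕜 (Hil a ha × Hil b hb)).symm.toLinearMap ∘ₗ
    (UniformSpace.Completion.toComplₗᵢ (𝕜 := 𝕜) (E := Ran a ha)).toLinearMap.prodMap
      (UniformSpace.Completion.toComplₗᵢ (𝕜 := 𝕜) (E := Ran b hb)).toLinearMap

theorem ι_injective (ha : IsPosSymm a) (hb : IsPosSymm b) (hd : Dense (fdom a ∩ fdom b)) :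
    Function.Injective (ι ha hb) := by
  rw [← LinearMap.ker_eq_bot, LinearMap.ker_eq_bot']
  rintro ⟨ξ, η⟩ h
  have h' : ((ξ : Hil a ha), (η : Hil b hb)) = 0 :=
    (WithLp.linearEquiv 2 𝕜 (Hil a ha × Hil b hb)).symm.map_eq_zero_iff.1 h
  obtain ⟨h1, h2⟩ := Prod.ext_iff.1 h'
  refine Prod.ext (Ran.eq_zero_of_norm_eq_zero ha (hd.mono Set.inter_subset_left) ?_)
    (Ran.eq_zero_of_norm_eq_zero hb (hd.mono Set.inter_subset_right) ?_)
  · rw [← UniformSpace.Completion.norm_coe]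
    exact norm_eq_zero.2 h1
  · rw [← UniformSpace.Completion.norm_coe]
    exact norm_eq_zero.2 h2

/-- The operator `J (a u ⊕ b v) = a u + b v` with domain `ran a ⊕ ran b`. -/
def J (ha : IsPosSymm a) (hb : IsPosSymm b) (hd : Dense (fdom a ∩ fdom b)) :
    WithLp 2 (Hil a ha × Hil b hb) →ₗ.[𝕜] H where
  domain := LinearMap.range (ι ha hb)
  toFun := (Ran.val ha).coprod (Ran.val hb) ∘ₗ
    (LinearEquiv.ofInjective (ι ha hb) (ι_injective ha hb hd)).symm.toLinearMap

/-- The product `T S` of partially defined operators, with its natural domain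
`{x ∈ dom S | S x ∈ dom T}`. -/
def opMul {E F G : Type*} [AddCommGroup E] [Module 𝕜 E] [AddCommGroup F] [Module 𝕜 F]
    [AddCommGroup G] [Module 𝕜 G] (T : F →ₗ.[𝕜] G) (S : E →ₗ.[𝕜] F) : E →ₗ.[𝕜] G where
  domain :=
    { carrier := {x | ∃ h : x ∈ S.domain, S ⟨x, h⟩ ∈ T.domain}
      zero_mem' := ⟨S.domain.zero_mem, (S.map_zero).symm ▸ T.domain.zero_mem⟩
      add_mem' := fun ⟨hx, hSx⟩ ⟨hy, hSy⟩ => ⟨S.domain.add_mem hx hy,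
        (S.map_add ⟨_, hx⟩ ⟨_, hy⟩).symm ▸ T.domain.add_mem hSx hSy⟩
      smul_mem' := fun c _ ⟨hx, hSx⟩ => ⟨S.domain.smul_mem c hx,
        (S.map_smul c ⟨_, hx⟩).symm ▸ T.domain.smul_mem c hSx⟩ }
  toFun :=
    { toFun := fun x => T ⟨S ⟨x, x.2.choose⟩, x.2.choose_spec⟩
      map_add' := fun x y => by
        rw [← T.map_add]
        exact congrArg T (Subtype.ext (S.map_add ⟨x, x.2.choose⟩ ⟨y, y.2.choose⟩))
      map_smul' := fun c x => by
        rw [RingHom.id_apply, ← T.map_smul]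
        exact congrArg T (Subtype.ext (S.map_smul c ⟨x, x.2.choose⟩)) }

/-- The form sum of `a` and `b`: the operator `J** J*`. -/
def formSum [CompleteSpace H] (a b : H →ₗ.[𝕜] H) (ha : IsPosSymm a) (hb : IsPosSymm b)
    (hd : Dense (fdom a ∩ fdom b)) : H →ₗ.[𝕜] H :=
  opMul (J ha hb hd).adjoint.adjoint (J ha hb hd).adjoint

end FormSum

end

/-! With `S = J†` the form sum is `S† S`, where `S` is closed (an adjoint) and densely defined (its
domain contains `fdom a ∩ fdom b`). The representation theorem `opMul_adjoint_eq_iff` says that `S†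
S` determines, and is determined by, the form `x ↦ ‖S x‖²` with value `∞` off the domain of `S`. The
auxiliary Hilbert space drops out, so form sums living over different completions can be compared.

It remains to compute this form. The components of `J† x` represent the functionals `a u ↦ (a u, x)`
and `b v ↦ (b v, x)` on the two completions, so duality turns `‖J† x‖²` into the sum of the two
suprema (`quadForm_adjoint_J`). Applied to `a, b` and to their restrictions to `D`, this gives the
two sides of the criterion. -/

open scoped InnerProductSpace

noncomputable section

namespace FormSum

open Filter Topology

open scoped LinearPMap

/-! ### Closed operators `S`, the product `S† S` and the form `‖S x‖²` -/

section ClosedOperator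

variable {𝕜 : Type*} [RCLike 𝕜] {H F G : Type*}
  [NormedAddCommGroup H] [InnerProductSpace 𝕜 H]
  [NormedAddCommGroup F] [InnerProductSpace 𝕜 F]
  [NormedAddCommGroup G] [InnerProductSpace 𝕜 G]

/-- The graph of a partially defined operator, as a subspace of the Hilbert space sum. -/
def l2Graph (S : H →ₗ.[𝕜] F) : Submodule 𝕜 (WithLp 2 (H × F)) :=
  S.graph.comap (WithLp.linearEquiv 2 𝕜 (H × F)).toLinearMap

theorem mem_l2Graph {S : H →ₗ.[𝕜] F} {p : WithLp 2 (H × F)} :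
    p ∈ l2Graph S ↔ ∃ x : S.domain, (x : H) = p.fst ∧ S x = p.snd := by
  change WithLp.ofLp p ∈ S.graph ↔ _
  rw [LinearPMap.mem_graph_iff]
  rfl

theorem isClosed_l2Graph {S : H →ₗ.[𝕜] F} (hS : S.IsClosed) :
    IsClosed (l2Graph S : Set (WithLp 2 (H × F))) :=
  IsClosed.preimage (WithLp.prod_continuous_ofLp 2 H F) hS

/-- The quadratic form `x ↦ ‖S x‖²` of an operator, with value `∞` outside its domain. -/
def quadForm (S : H →ₗ.[𝕜] F) (x : H) : ENNReal := ⨅ h : x ∈ S.domain, ‖S ⟨x, h⟩‖ₑ ^ 2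

theorem quadForm_of_mem (S : H →ₗ.[𝕜] F) {x : H} (h : x ∈ S.domain) :
    quadForm S x = ‖S ⟨x, h⟩‖ₑ ^ 2 := iInf_pos h

theorem quadForm_of_notMem (S : H →ₗ.[𝕜] F) {x : H} (h : x ∉ S.domain) :
    quadForm S x = ⊤ := iInf_neg h

theorem mem_domain_iff_quadForm_ne_top (S : H →ₗ.[𝕜] F) {x : H} :
    x ∈ S.domain ↔ quadForm S x ≠ ⊤ := by
  by_cases h : x ∈ S.domain
  · simp [quadForm_of_mem S h, h]
  · simp [quadForm_of_notMem S h, h]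

theorem quadForm_eq_iff {S : H →ₗ.[𝕜] F} {T : H →ₗ.[𝕜] G} :
    (∀ x, quadForm S x = quadForm T x) ↔
      ∃ h : S.domain = T.domain, ∀ x : S.domain, ‖S x‖ = ‖T ⟨x, h ▸ x.2⟩‖ := by
  constructor
  · intro h
    have hdom : S.domain = T.domain := by
      ext x
      rw [mem_domain_iff_quadForm_ne_top, h, mem_domain_iff_quadForm_ne_top]
    refine ⟨hdom, fun x => ?_⟩
    have h1 := h x
    rw [quadForm_of_mem S x.2, quadForm_of_mem T (hdom ▸ x.2)] at h1
    have h2 := (ENNReal.pow_right_strictMono two_ne_zero).injective h1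
    simpa [enorm_eq_iff_norm_eq] using h2
  · rintro ⟨hdom, h⟩ x
    by_cases hx : x ∈ S.domain
    · have h1 := h ⟨x, hx⟩
      rw [quadForm_of_mem S hx, quadForm_of_mem T (hdom ▸ hx), enorm_eq_iff_norm_eq.2 h1]
    · rw [quadForm_of_notMem S hx, quadForm_of_notMem T (hdom ▸ hx)]

variable [CompleteSpace H]

theorem inner_opMul_adjoint {S : H →ₗ.[𝕜] F} (hd : Dense (S.domain : Set H))
    (y : (opMul S† S).domain) (z : S.domain) :
    ⟪opMul S† S y, (z : H)⟫_𝕜 = ⟪S ⟨y, y.2.choose⟩, S z⟫_𝕜 :=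
  LinearPMap.adjoint_isFormalAdjoint hd ⟨_, y.2.choose_spec⟩ z

/-- `1 + S* S` is surjective. -/
theorem exists_add_opMul_adjoint_eq [CompleteSpace F] {S : H →ₗ.[𝕜] F} (hS : S.IsClosed)
    (hd : Dense (S.domain : Set H)) (h : H) :
    ∃ y : (opMul S† S).domain, (y : H) + opMul S† S y = h := by
  have : CompleteSpace (l2Graph S) := (isClosed_l2Graph hS).completeSpace_coe
  -- Project `(h, 0)` onto the closed graph: `p = (y, S y)`, `q = (h - y, -S y)`. Orthogonality of
  -- `q` to the graph says exactly that `S† S y = h - y`.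
  obtain ⟨p, hp, q, hq, hpq⟩ :=
    (l2Graph S).exists_add_mem_mem_orthogonal (WithLp.toLp 2 (h, (0 : F)))
  obtain ⟨y, hy1, hy2⟩ := mem_l2Graph.1 hp
  have key : ∀ z : S.domain, ⟪h - y, (z : H)⟫_𝕜 = ⟪S y, S z⟫_𝕜 := by
    intro z
    have h1 := (Submodule.mem_orthogonal' _ _).1 hq (WithLp.toLp 2 ((z : H), S z))
      (mem_l2Graph.2 ⟨z, rfl, rfl⟩)
    have h2 : q = WithLp.toLp 2 (h, (0 : F)) - p := by rw [hpq]; abel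
    rw [h2, WithLp.prod_inner_apply] at h1
    have h3 : ⟪h - y, (z : H)⟫_𝕜 + ⟪0 - S y, S z⟫_𝕜 = 0 := by rw [hy1, hy2]; exact h1
    rw [zero_sub, inner_neg_left] at h3
    exact add_neg_eq_zero.1 h3
  have hm : S y ∈ S†.domain := LinearPMap.mem_adjoint_domain_of_exists _ ⟨_, key⟩
  refine ⟨⟨y, y.2, hm⟩, ?_⟩
  have : opMul S† S ⟨y, y.2, hm⟩ = h - y :=
    LinearPMap.adjoint_apply_eq hd ⟨S y, hm⟩ key
  rw [this]
  simp

/-- The domain of `S* S` is a core of the closed operator `S`. -/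
theorem exists_seq_opMul_adjoint [CompleteSpace F] {S : H →ₗ.[𝕜] F} (hS : S.IsClosed)
    (hd : Dense (S.domain : Set H)) (x : S.domain) :
    ∃ u : ℕ → (opMul S† S).domain, Tendsto (fun n => (u n : H)) atTop (𝓝 x) ∧
      Tendsto (fun n => S ⟨u n, (u n).2.choose⟩) atTop (𝓝 (S x)) := by
  let f : (opMul S† S).domain →ₗ[𝕜] S.domain := Submodule.inclusion fun y hy => hy.choose
  let j : (opMul S† S).domain →ₗ[𝕜] WithLp 2 (H × F) :=
    (WithLp.linearEquiv 2 𝕜 (H × F)).symm.toLinearMap ∘ₗ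
      (S.domain.subtype.prod S.toFun) ∘ₗ f
  have hj : ∀ y, j y = WithLp.toLp 2 ((y : H), S ⟨y, y.2.choose⟩) := fun _ => rfl
  let K := (LinearMap.range j).topologicalClosure
  have hK : K ≤ l2Graph S := by
    refine Submodule.topologicalClosure_minimal _ ?_ (isClosed_l2Graph hS)
    rintro _ ⟨y, rfl⟩
    exact mem_l2Graph.2 ⟨f y, rfl, rfl⟩
  have : CompleteSpace K := (LinearMap.range j).isClosed_topologicalClosure.completeSpace_coe
  obtain ⟨p, hp, q, hq, hpq⟩ :=
    K.exists_add_mem_mem_orthogonal (WithLp.toLp 2 ((x : H), S x))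
  have hq' : q ∈ l2Graph S := by
    have : q = WithLp.toLp 2 ((x : H), S x) - p := by rw [hpq]; abel
    rw [this]
    exact sub_mem (mem_l2Graph.2 ⟨x, rfl, rfl⟩) (hK hp)
  obtain ⟨z, hz1, hz2⟩ := mem_l2Graph.1 hq'
  -- The residual `q = (z, S z)` is orthogonal to each `(y, S y)` with `y` in the domain of `S† S`,
  -- so `y + S† S y ⊥ z`. Surjectivity of `1 + S† S` lets `z` itself be chosen as the left side.
  have hz0 : (z : H) = 0 := by
    obtain ⟨y, hy⟩ := exists_add_opMul_adjoint_eq hS hd (z : H)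
    have h1 := (Submodule.mem_orthogonal _ _).1 hq (j y)
      (Submodule.le_topologicalClosure _ ⟨y, rfl⟩)
    rw [hj, WithLp.prod_inner_apply] at h1
    have h2 : ⟪(y : H), (z : H)⟫_𝕜 + ⟪S ⟨y, y.2.choose⟩, S z⟫_𝕜 = 0 := by
      rw [hz1, hz2]; exact h1
    rw [← inner_opMul_adjoint hd, ← inner_add_left, hy] at h2
    exact inner_self_eq_zero.1 h2
  have hx : WithLp.toLp 2 ((x : H), S x) ∈ closure (Set.range j) := by
    have hq0 : q = 0 := by
      have hz : z = 0 := Subtype.ext hz0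
      rw [hz, LinearPMap.map_zero] at hz2
      rw [hz0] at hz1
      exact WithLp.ofLp_injective 2 (Prod.ext hz1.symm hz2.symm)
    rw [hpq, hq0, add_zero]
    exact hp
  obtain ⟨v, hv, hvx⟩ := mem_closure_iff_seq_limit.1 hx
  choose u hu using hv
  obtain rfl : (fun n => j (u n)) = v := funext hu
  have h := (WithLp.prod_continuous_ofLp 2 H F).continuousAt.tendsto.comp hvx
  exact ⟨u, (continuous_fst.tendsto _).comp h, (continuous_snd.tendsto _).comp h⟩

/-- Both squared norms equal the inner product of `S† S y` with `y`. -/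
theorem norm_eq_of_opMul_adjoint_eq {S : H →ₗ.[𝕜] F} {T : H →ₗ.[𝕜] G}
    (hdS : Dense (S.domain : Set H)) (hdT : Dense (T.domain : Set H))
    (h : opMul S† S = opMul T† T) (y : (opMul S† S).domain)
    (hy : (y : H) ∈ T.domain) : ‖S ⟨y, y.2.choose⟩‖ = ‖T ⟨y, hy⟩‖ := by
  have hy' : (y : H) ∈ (opMul T† T).domain := h ▸ y.2
  have h1 : opMul S† S y = opMul T† T ⟨y, hy'⟩ := (LinearPMap.dExt_iff.1 h).2 rfl
  have h2 := inner_opMul_adjoint hdS y ⟨y, y.2.choose⟩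
  have h3 := inner_opMul_adjoint hdT ⟨y, hy'⟩ ⟨y, hy⟩
  rw [h1] at h2
  have h4 := h2.symm.trans h3
  rw [inner_self_eq_norm_sq_to_K, inner_self_eq_norm_sq_to_K] at h4
  exact (pow_left_inj₀ (norm_nonneg _) (norm_nonneg _) two_ne_zero).1 (by exact_mod_cast h4)

/-- Approximate `x` in the graph norm of `S` from the core. There `S` and `T` have equal norms, so
the images under `T` are Cauchy too, and closedness of `T` passes to the limit. -/
theorem exists_mem_domain_norm_eq_of_opMul_adjoint_eq [CompleteSpace F] [CompleteSpace G]
    {S : H →ₗ.[𝕜] F} {T : H →ₗ.[𝕜] G} (hS : S.IsClosed) (hT : T.IsClosed)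
    (hdS : Dense (S.domain : Set H)) (hdT : Dense (T.domain : Set H))
    (h : opMul S† S = opMul T† T) (x : S.domain) :
    ∃ hx : (x : H) ∈ T.domain, ‖T ⟨x, hx⟩‖ = ‖S x‖ := by
  obtain ⟨u, hu, hSu⟩ := exists_seq_opMul_adjoint hS hdS x
  have hm : ∀ y : (opMul S† S).domain, (y : H) ∈ T.domain := fun y => by
    have hy : (y : H) ∈ (opMul T† T).domain := h ▸ y.2
    exact hy.choose
  have hnorm : ∀ y : (opMul S† S).domain, ‖T ⟨y, hm y⟩‖ = ‖S ⟨y, y.2.choose⟩‖ := fun y =>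
    (norm_eq_of_opMul_adjoint_eq hdS hdT h y (hm y)).symm
  have hc : CauchySeq fun n => T ⟨u n, hm (u n)⟩ := by
    have hc' := hSu.cauchySeq
    rw [Metric.cauchySeq_iff] at hc' ⊢
    intro ε hε
    obtain ⟨N, hN⟩ := hc' ε hε
    refine ⟨N, fun m hm' n hn => ?_⟩
    have := hN m hm' n hn
    rw [dist_eq_norm, ← LinearPMap.map_sub] at this ⊢
    exact (hnorm (u m - u n)).trans_lt this
  obtain ⟨w, hw⟩ := cauchySeq_tendsto_of_complete hc
  have hg : ((x : H), w) ∈ T.graph := by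
    refine hT.mem_of_tendsto (hu.prodMk_nhds hw) (Eventually.of_forall fun n => ?_)
    exact T.mem_graph ⟨u n, hm (u n)⟩
  obtain ⟨x', hx', hw'⟩ := (T.mem_graph_iff).1 hg
  have hx : (x : H) ∈ T.domain := by
    have := x'.2
    rwa [hx'] at this
  obtain rfl : x' = ⟨x, hx⟩ := Subtype.ext hx'
  refine ⟨hx, ?_⟩
  rw [hw']
  refine tendsto_nhds_unique hw.norm ?_
  simp_rw [hnorm]
  exact hSu.norm

/-- The representation theorem for closed nonnegative forms: `S* S` determines the form
`x ↦ ‖S x‖²` and is determined by it. -/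
theorem opMul_adjoint_eq_iff [CompleteSpace F] [CompleteSpace G]
    {S : H →ₗ.[𝕜] F} {T : H →ₗ.[𝕜] G} (hS : S.IsClosed) (hT : T.IsClosed)
    (hdS : Dense (S.domain : Set H)) (hdT : Dense (T.domain : Set H)) :
    opMul S† S = opMul T† T ↔ ∀ x, quadForm S x = quadForm T x := by
  rw [quadForm_eq_iff]
  constructor
  · intro h
    have h1 := exists_mem_domain_norm_eq_of_opMul_adjoint_eq hS hT hdS hdT h
    have h2 := exists_mem_domain_norm_eq_of_opMul_adjoint_eq hT hS hdT hdS h.symm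
    exact ⟨le_antisymm (fun x hx => (h1 ⟨x, hx⟩).1) fun x hx => (h2 ⟨x, hx⟩).1,
      fun x => (h1 x).2.symm⟩
  · rintro ⟨hdom, h⟩
    have hsub : ∀ x : T.domain, (x : H) ∈ S.domain := fun x => hdom.ge x.2
    -- Polarization: equal norms on a common domain give equal inner products.
    have hin : ∀ x y : S.domain, ⟪S x, S y⟫_𝕜 = ⟪T ⟨x, hdom ▸ x.2⟩, T ⟨y, hdom ▸ y.2⟩⟫_𝕜 := by
      intro x y
      let f : S.domain →ₗ[𝕜] T.domain := Submodule.inclusion hdom.le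
      have hf : ∀ x, ‖S.toFun x‖ = ‖T.toFun (f x)‖ := h
      change ⟪S.toFun x, S.toFun y⟫_𝕜 = ⟪T.toFun (f x), T.toFun (f y)⟫_𝕜
      simp only [inner_eq_sum_norm_sq_div_four, ← map_add, ← map_sub, ← map_smul, hf]
    have hadj : ∀ (x : S.domain) (w : H), (∀ z : S.domain, ⟪w, (z : H)⟫_𝕜 = ⟪S x, S z⟫_𝕜) ↔
        ∀ z : T.domain, ⟪w, (z : H)⟫_𝕜 = ⟪T ⟨x, hdom ▸ x.2⟩, T z⟫_𝕜 := by
      intro x w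
      exact ⟨fun hw z => (hw ⟨z, hsub z⟩).trans (hin x ⟨z, hsub z⟩),
        fun hw z => (hw ⟨z, hdom.le z.2⟩).trans (hin x z).symm⟩
    have hd' : ∀ x, x ∈ (opMul S† S).domain → x ∈ (opMul T† T).domain := by
      intro x hx
      exact ⟨hdom ▸ hx.choose, LinearPMap.mem_adjoint_domain_of_exists _
        ⟨_, (hadj ⟨x, hx.choose⟩ _).1 (inner_opMul_adjoint hdS ⟨x, hx⟩)⟩⟩
    refine LinearPMap.dExt (le_antisymm hd' ?_) ?_
    · intro x hx
      exact ⟨hdom ▸ hx.choose, LinearPMap.mem_adjoint_domain_of_exists _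
        ⟨_, (hadj ⟨x, hdom.ge hx.choose⟩ _).2 (inner_opMul_adjoint hdT ⟨x, hx⟩)⟩⟩
    · rintro ⟨x, hx⟩ ⟨_, hy⟩ rfl
      refine hdT.eq_of_inner_left 𝕜 fun z hz => ?_
      exact ((hadj ⟨x, hx.choose⟩ _).1 (inner_opMul_adjoint hdS ⟨x, hx⟩) ⟨z, hz⟩).trans
        (inner_opMul_adjoint hdT ⟨x, hy⟩ ⟨z, hz⟩).symm

end ClosedOperator

/-! ### Duality in the completion of a seminormed space -/

section Completion

variable {𝕜 : Type*} [RCLike 𝕜] {V : Type*} [SeminormedAddCommGroup V] [InnerProductSpace 𝕜 V]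

/-- The bound extends from `V` to its completion by density; then `z` is tested against itself. -/
theorem norm_le_of_forall_norm_inner_coe_le (z : UniformSpace.Completion V) {M : ℝ}
    (h : ∀ ξ : V, ‖ξ‖ ≤ 1 → ‖⟪(ξ : UniformSpace.Completion V), z⟫_𝕜‖ ≤ M) : ‖z‖ ≤ M := by
  have hM : 0 ≤ M := (norm_nonneg _).trans (h 0 (by simp))
  have h1 : ∀ ξ : V, ‖⟪(ξ : UniformSpace.Completion V), z⟫_𝕜‖ ≤ ‖ξ‖ * M := by
    intro ξ
    -- On a seminormed space a null vector cannot be normalized; Cauchy–Schwarz handles it.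
    rcases eq_or_ne ‖ξ‖ 0 with h0 | h0
    · have := norm_inner_le_norm (𝕜 := 𝕜) (ξ : UniformSpace.Completion V) z
      rw [UniformSpace.Completion.norm_coe, h0, zero_mul] at this
      rwa [h0, zero_mul]
    · have h2 := h (((‖ξ‖⁻¹ : ℝ) : 𝕜) • ξ) (by simp [norm_smul, h0])
      rw [UniformSpace.Completion.coe_smul, inner_smul_left, norm_mul] at h2
      have h3 : ‖(starRingEnd 𝕜) ((‖ξ‖⁻¹ : ℝ) : 𝕜)‖ = ‖ξ‖⁻¹ := by simp
      rw [h3] at h2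
      have hpos : 0 < ‖ξ‖ := lt_of_le_of_ne (norm_nonneg _) h0.symm
      rwa [inv_mul_le_iff₀ hpos] at h2
  have h2 : ∀ w : UniformSpace.Completion V, ‖⟪w, z⟫_𝕜‖ ≤ ‖w‖ * M := by
    intro w
    induction w using UniformSpace.Completion.induction_on with
    | hp => exact isClosed_le (by fun_prop) (by fun_prop)
    | ih ξ => rw [UniformSpace.Completion.norm_coe]; exact h1 ξ
  rcases eq_or_ne z 0 with rfl | hz
  · simpa using hM
  · have h3 := h2 z
    rw [inner_self_eq_norm_sq_to_K, norm_pow, RCLike.norm_ofReal, abs_norm, sq] at h3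
    exact le_of_mul_le_mul_left h3 (norm_pos_iff.2 hz)

/-- Computing the norm in the completion by duality. -/
theorem iSup_enorm_inner_coe_sq (z : UniformSpace.Completion V) :
    (⨆ (ξ : V) (_ : ‖ξ‖ ≤ 1), ‖⟪(ξ : UniformSpace.Completion V), z⟫_𝕜‖ₑ ^ 2) = ‖z‖ₑ ^ 2 := by
  refine le_antisymm (iSup₂_le fun ξ hξ => ?_) ?_
  · gcongr
    rw [← ofReal_norm, ← ofReal_norm]
    refine ENNReal.ofReal_le_ofReal ((norm_inner_le_norm _ _).trans ?_)
    rw [UniformSpace.Completion.norm_coe]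
    exact mul_le_of_le_one_left (norm_nonneg _) hξ
  · set s := ⨆ (ξ : V) (_ : ‖ξ‖ ≤ 1), ‖⟪(ξ : UniformSpace.Completion V), z⟫_𝕜‖ₑ ^ 2 with hs
    by_cases htop : s = ⊤
    · rw [htop]; exact le_top
    have h := norm_le_of_forall_norm_inner_coe_le (𝕜 := 𝕜) z (M := √s.toReal) fun ξ hξ => by
      refine Real.le_sqrt_of_sq_le ?_
      have h1 : ‖⟪(ξ : UniformSpace.Completion V), z⟫_𝕜‖ₑ ^ 2 ≤ s :=
        le_iSup₂ (f := fun (ξ : V) (_ : ‖ξ‖ ≤ 1) =>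
          ‖⟪(ξ : UniformSpace.Completion V), z⟫_𝕜‖ₑ ^ 2) ξ hξ
      have h2 := ENNReal.toReal_mono htop h1
      simpa using h2
    rw [← ENNReal.ofReal_toReal htop, ← ofReal_norm, ← ENNReal.ofReal_pow (norm_nonneg _)]
    refine ENNReal.ofReal_le_ofReal ?_
    rw [← Real.sq_sqrt (ENNReal.toReal_nonneg : 0 ≤ s.toReal)]
    gcongr

end Completion

/-! ### Suprema, form domains and the operator `J†` -/

section FormSumOperator

variable {𝕜 : Type*} [RCLike 𝕜] {H : Type*} [NormedAddCommGroup H] [InnerProductSpace 𝕜 H]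
  {a b : H →ₗ.[𝕜] H}

theorem Ran.norm_sq_mk (ha : IsPosSymm a) (u : a.domain) :
    ‖Ran.mk ha u‖ ^ 2 = RCLike.re ⟪a u, (u : H)⟫_𝕜 := by
  rw [← Ran.inner_mk ha, inner_self_eq_norm_sq]

theorem Ran.norm_mk_le_one_iff (ha : IsPosSymm a) (u : a.domain) :
    ‖Ran.mk ha u‖ ≤ 1 ↔ RCLike.re ⟪a u, (u : H)⟫_𝕜 ≤ 1 := by
  rw [← Ran.norm_sq_mk ha, sq_le_one_iff₀ (norm_nonneg _)]

theorem Ran.mk_surjective (ha : IsPosSymm a) : Function.Surjective (Ran.mk ha) :=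
  fun ξ => ⟨_, Ran.mk_pre ha ξ⟩

theorem Ran.iSup_eq (ha : IsPosSymm a) (x : H) :
    (⨆ (ξ : Ran a ha) (_ : ‖ξ‖ ≤ 1), ‖⟪ξ.val ha, x⟫_𝕜‖ₑ ^ 2) =
      ⨆ (u : a.domain) (_ : RCLike.re ⟪a u, (u : H)⟫_𝕜 ≤ 1), ‖⟪a u, x⟫_𝕜‖ₑ ^ 2 := by
  rw [← (Ran.mk_surjective ha).iSup_comp]
  simp only [Ran.norm_mk_le_one_iff]
  rfl

theorem Ran.exists_bound (ha : IsPosSymm a) {x : H} (hx : x ∈ fdom a) :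
    ∃ M : ℝ, ∀ ξ : Ran a ha, ‖⟪ξ.val ha, x⟫_𝕜‖ ≤ M * ‖ξ‖ := by
  obtain ⟨m, hm⟩ := hx
  refine ⟨√m, fun ξ => ?_⟩
  obtain ⟨u, rfl⟩ := Ran.mk_surjective ha ξ
  have h := hm u
  rw [← Ran.norm_sq_mk ha] at h
  calc ‖⟪(Ran.mk ha u).val ha, x⟫_𝕜‖ ≤ √(m * ‖Ran.mk ha u‖ ^ 2) := Real.le_sqrt_of_sq_le h
    _ = √m * ‖Ran.mk ha u‖ := by rw [Real.sqrt_mul' _ (sq_nonneg _), Real.sqrt_sq (norm_nonneg _)]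

/-- Vectors at which the supremum is finite belong to the form domain. -/
theorem mem_fdom_of_iSup_ne_top (ha : IsPosSymm a) (hd : Dense (fdom a)) {x : H}
    (h : (⨆ (u : a.domain) (_ : RCLike.re ⟪a u, (u : H)⟫_𝕜 ≤ 1), ‖⟪a u, x⟫_𝕜‖ₑ ^ 2) ≠ ⊤) :
    x ∈ fdom a := by
  set s := ⨆ (u : a.domain) (_ : RCLike.re ⟪a u, (u : H)⟫_𝕜 ≤ 1), ‖⟪a u, x⟫_𝕜‖ₑ ^ 2 with hs
  refine ⟨s.toReal, fun u => ?_⟩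
  rw [← Ran.norm_sq_mk ha]
  rcases eq_or_ne ‖Ran.mk ha u‖ 0 with h0 | h0
  -- Rescaling is impossible when `(a u, u) = 0`, but density of the form domain then forces `a u =
  -- 0`.
  · have h1 : a u = 0 := congrArg (Ran.val ha) (Ran.eq_zero_of_norm_eq_zero ha hd h0)
    simp [h1, h0]
  · set r := ‖Ran.mk ha u‖ with hr
    have h1 : RCLike.re ⟪a (((r⁻¹ : ℝ) : 𝕜) • u), (((r⁻¹ : ℝ) : 𝕜) • u : a.domain)⟫_𝕜 ≤ 1 := by
      rw [← Ran.norm_mk_le_one_iff ha]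
      have : Ran.mk ha (((r⁻¹ : ℝ) : 𝕜) • u) = ((r⁻¹ : ℝ) : 𝕜) • Ran.mk ha u :=
        Subtype.ext (a.map_smul _ _)
      rw [this, norm_smul]
      have hr0 : 0 ≤ r := norm_nonneg _
      simp [← hr, abs_of_nonneg hr0, inv_mul_cancel₀ h0]
    have h2 : ‖⟪a (((r⁻¹ : ℝ) : 𝕜) • u), x⟫_𝕜‖ₑ ^ 2 ≤ s :=
      le_iSup₂ (f := fun (u : a.domain) (_ : RCLike.re ⟪a u, (u : H)⟫_𝕜 ≤ 1) =>
        ‖⟪a u, x⟫_𝕜‖ₑ ^ 2) _ h1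
    have h3 := ENNReal.toReal_mono h h2
    rw [LinearPMap.map_smul, inner_smul_left] at h3
    have h4 : r⁻¹ ^ 2 * ‖⟪a u, x⟫_𝕜‖ ^ 2 ≤ s.toReal := by
      simpa [mul_pow] using h3
    have hpos : 0 < r ^ 2 := by positivity
    rw [inv_pow, inv_mul_le_iff₀ hpos] at h4
    linarith

variable (ha : IsPosSymm a) (hb : IsPosSymm b) (hd : Dense (fdom a ∩ fdom b))

theorem dense_domain_J : Dense ((J ha hb hd).domain : Set (WithLp 2 (Hil a ha × Hil b hb))) := by
  have h : DenseRange (ι ha hb) := by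
    have h1 : DenseRange (Prod.map ((↑) : Ran a ha → Hil a ha) ((↑) : Ran b hb → Hil b hb)) :=
      UniformSpace.Completion.denseRange_coe.prodMap UniformSpace.Completion.denseRange_coe
    have h2 : DenseRange (WithLp.toLp 2 : Hil a ha × Hil b hb → _) :=
      (WithLp.toLp_surjective 2).denseRange
    exact h2.comp h1 (WithLp.prod_continuous_toLp 2 _ _)
  exact h

/-- The vector `ι (ξ, η)` as an element of the domain of `J`. -/
def domJ (p : Ran a ha × Ran b hb) : (J ha hb hd).domain := ⟨ι ha hb p, p, rfl⟩

theorem domJ_surjective : Function.Surjective (domJ ha hb hd) := by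
  rintro ⟨_, p, rfl⟩
  exact ⟨p, rfl⟩

theorem J_domJ (p : Ran a ha × Ran b hb) :
    J ha hb hd (domJ ha hb hd p) = p.1.val ha + p.2.val hb := by
  change ((Ran.val ha).coprod (Ran.val hb)) ((LinearEquiv.ofInjective (ι ha hb)
    (ι_injective ha hb hd)).symm (LinearEquiv.ofInjective (ι ha hb)
    (ι_injective ha hb hd) p)) = _
  rw [LinearEquiv.symm_apply_apply]
  rfl

theorem mem_adjoint_J_of_mem_fdom {x : H} (hx : x ∈ fdom a ∩ fdom b) :
    x ∈ (J ha hb hd)†.domain := by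
  obtain ⟨M, hM⟩ := Ran.exists_bound ha hx.1
  obtain ⟨N, hN⟩ := Ran.exists_bound hb hx.2
  rw [LinearPMap.mem_adjoint_domain_iff]
  refine AddMonoidHomClass.continuous_of_bound _ (|M| + |N|) fun w => ?_
  obtain ⟨⟨ξ, η⟩, rfl⟩ := domJ_surjective ha hb hd w
  have h1 : ‖ξ‖ ≤ ‖domJ ha hb hd (ξ, η)‖ := by
    have h := WithLp.norm_fst_le _ (WithLp.toLp 2 ((ξ : Hil a ha), (η : Hil b hb)))
    rw [← UniformSpace.Completion.norm_coe ξ]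
    exact h
  have h2 : ‖η‖ ≤ ‖domJ ha hb hd (ξ, η)‖ := by
    have h := WithLp.norm_snd_le _ (WithLp.toLp 2 ((ξ : Hil a ha), (η : Hil b hb)))
    rw [← UniformSpace.Completion.norm_coe η]
    exact h
  change ‖⟪x, J ha hb hd (domJ ha hb hd (ξ, η))⟫_𝕜‖ ≤ _
  rw [norm_inner_symm, J_domJ, inner_add_left, add_mul]
  refine (norm_add_le _ _).trans (add_le_add ?_ ?_)
  · exact (hM ξ).trans (mul_le_mul (le_abs_self M) h1 (norm_nonneg _) (abs_nonneg _))
  · exact (hN η).trans (mul_le_mul (le_abs_self N) h2 (norm_nonneg _) (abs_nonneg _))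

theorem dense_domain_adjoint_J : Dense ((J ha hb hd)†.domain : Set H) :=
  hd.mono fun _ => mem_adjoint_J_of_mem_fdom ha hb hd

theorem inner_adjoint_J (x : (J ha hb hd)†.domain) (p : Ran a ha × Ran b hb) :
    ⟪ι ha hb p, (J ha hb hd)† x⟫_𝕜 = ⟪p.1.val ha + p.2.val hb, (x : H)⟫_𝕜 := by
  have h := (LinearPMap.adjoint_isFormalAdjoint (dense_domain_J ha hb hd)).symm
    (domJ ha hb hd p) x
  rw [J_domJ] at h
  exact h.symm

/-- The form of `J*` is the sum of the suprema. -/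
theorem quadForm_adjoint_J (x : H) :
    quadForm (J ha hb hd)† x =
      (⨆ (u : a.domain) (_ : RCLike.re ⟪a u, (u : H)⟫_𝕜 ≤ 1), ‖⟪a u, x⟫_𝕜‖ₑ ^ 2) +
        ⨆ (v : b.domain) (_ : RCLike.re ⟪b v, (v : H)⟫_𝕜 ≤ 1), ‖⟪b v, x⟫_𝕜‖ₑ ^ 2 := by
  by_cases hx : x ∈ (J ha hb hd)†.domain
  · set z := (J ha hb hd)† ⟨x, hx⟩ with hz
    have hι : ∀ p : Ran a ha × Ran b hb, ⟪ι ha hb p, z⟫_𝕜 =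
        ⟪(p.1 : Hil a ha), z.fst⟫_𝕜 + ⟪(p.2 : Hil b hb), z.snd⟫_𝕜 := fun p =>
      WithLp.prod_inner_apply _ _
    -- Testing against `ι (ξ, 0)` isolates the first component of `J† x`.
    have h1 : ∀ ξ : Ran a ha, ⟪(ξ : Hil a ha), z.fst⟫_𝕜 = ⟪ξ.val ha, x⟫_𝕜 := fun ξ => by
      have h := inner_adjoint_J ha hb hd ⟨x, hx⟩ (ξ, 0)
      rw [← hz, hι] at h
      simpa [UniformSpace.Completion.coe_zero] using h
    have h2 : ∀ η : Ran b hb, ⟪(η : Hil b hb), z.snd⟫_𝕜 = ⟪η.val hb, x⟫_𝕜 := fun η => by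
      have h := inner_adjoint_J ha hb hd ⟨x, hx⟩ (0, η)
      rw [← hz, hι] at h
      simpa [UniformSpace.Completion.coe_zero] using h
    rw [quadForm_of_mem _ hx, ← Ran.iSup_eq ha, ← Ran.iSup_eq hb]
    simp_rw [← h1, ← h2, iSup_enorm_inner_coe_sq]
    rw [← hz, ← ofReal_norm, ← ofReal_norm, ← ofReal_norm, ← ENNReal.ofReal_pow (norm_nonneg _),
      ← ENNReal.ofReal_pow (norm_nonneg _), ← ENNReal.ofReal_pow (norm_nonneg _),
      ← ENNReal.ofReal_add (by positivity) (by positivity), WithLp.prod_norm_sq_eq_of_L2]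
  · rw [quadForm_of_notMem _ hx]
    -- If both suprema were finite, `x` would lie in both form domains, hence in the domain of `J†`.
    by_contra h
    obtain ⟨h1, h2⟩ := ENNReal.add_ne_top.1 (Ne.symm h)
    exact hx (mem_adjoint_J_of_mem_fdom ha hb hd
      ⟨mem_fdom_of_iSup_ne_top ha (hd.mono Set.inter_subset_left) h1,
        mem_fdom_of_iSup_ne_top hb (hd.mono Set.inter_subset_right) h2⟩)

theorem isClosed_adjoint_J : (J ha hb hd)†.IsClosed :=
  LinearPMap.adjoint_isClosed (dense_domain_J ha hb hd)

/-- Two form sums agree if and only if the associated closed forms agree. -/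
theorem formSum_eq_iff [CompleteSpace H] {c d : H →ₗ.[𝕜] H} (hc : IsPosSymm c)
    (hd' : IsPosSymm d) (hcd : Dense (fdom c ∩ fdom d)) :
    formSum a b ha hb hd = formSum c d hc hd' hcd ↔
      ∀ x, quadForm (J ha hb hd)† x = quadForm (J hc hd' hcd)† x :=
  opMul_adjoint_eq_iff (isClosed_adjoint_J ha hb hd) (isClosed_adjoint_J hc hd' hcd)
    (dense_domain_adjoint_J ha hb hd) (dense_domain_adjoint_J hc hd' hcd)

theorem iSup_domRestrict (a : H →ₗ.[𝕜] H) (D : Submodule 𝕜 H) (x : H) :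
    (⨆ (u : (a.domRestrict D).domain) (_ : RCLike.re ⟪a.domRestrict D u, (u : H)⟫_𝕜 ≤ 1),
        ‖⟪a.domRestrict D u, x⟫_𝕜‖ₑ ^ 2) =
      ⨆ (u : a.domain) (_ : (u : H) ∈ D) (_ : RCLike.re ⟪a u, (u : H)⟫_𝕜 ≤ 1),
        ‖⟪a u, x⟫_𝕜‖ₑ ^ 2 := by
  refine le_antisymm (iSup₂_le fun u hu => ?_) (iSup_le fun u => iSup₂_le fun huD hu => ?_)
  · exact le_iSup_of_le (Submodule.inclusion inf_le_right u)
      (le_iSup₂_of_le (Submodule.mem_inf.1 u.2).1 hu le_rfl)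
  · exact le_iSup₂_of_le (f := fun (u : (a.domRestrict D).domain)
      (_ : RCLike.re ⟪a.domRestrict D u, (u : H)⟫_𝕜 ≤ 1) => ‖⟪a.domRestrict D u, x⟫_𝕜‖ₑ ^ 2)
      ⟨u, Submodule.mem_inf.2 ⟨huD, u.2⟩⟩ hu le_rfl

end FormSumOperator

end FormSum

end

theorem theorem6 {𝕜 : Type*} [RCLike 𝕜] {H : Type*} [NormedAddCommGroup H]
    [InnerProductSpace 𝕜 H] [CompleteSpace H] (a b : H →ₗ.[𝕜] H)
    (ha : FormSum.IsPosSymm a) (hb : FormSum.IsPosSymm b)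
    (hd : Dense (FormSum.fdom a ∩ FormSum.fdom b))
    (D : Submodule 𝕜 H) (hD : D ≤ a.domain ⊓ b.domain) :
    FormSum.formSum (a.domRestrict D) (b.domRestrict D) (ha.domRestrict D) (hb.domRestrict D)
        (FormSum.dense_fdom_inter_domRestrict hd D) = FormSum.formSum a b ha hb hd ↔
      ∀ x : H,
        (⨆ (u : a.domain) (_ : RCLike.re ⟪a u, (u : H)⟫_𝕜 ≤ 1), ‖⟪a u, x⟫_𝕜‖ₑ ^ 2) +
            (⨆ (v : b.domain) (_ : RCLike.re ⟪b v, (v : H)⟫_𝕜 ≤ 1), ‖⟪b v, x⟫_𝕜‖ₑ ^ 2) =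
          (⨆ (u : a.domain) (_ : (u : H) ∈ D) (_ : RCLike.re ⟪a u, (u : H)⟫_𝕜 ≤ 1),
              ‖⟪a u, x⟫_𝕜‖ₑ ^ 2) +
            (⨆ (v : b.domain) (_ : (v : H) ∈ D) (_ : RCLike.re ⟪b v, (v : H)⟫_𝕜 ≤ 1),
              ‖⟪b v, x⟫_𝕜‖ₑ ^ 2) := by
  rw [FormSum.formSum_eq_iff]
  simp_rw [FormSum.quadForm_adjoint_J, FormSum.iSup_domRestrict]
  exact forall_congr' fun x => eq_comm
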